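/- Let $\mathcal N=(G,d,s,t)$ be a quantum tensor network: $G=(V,E)$ is a finite undirected (simple) graph, $d:E\to\mathbb N_{\ge 2}$ assigns a dimension to each edge, and $s\neq t$ are two vertices, the source and the sink. For $u\in V$ let $E(u)$ be the set of edges containing $u$. Given an arbitrary tensor $\mathcal T_u\in\bigotimes_{e\in E(u)}\mathbb C^{d_e}$ for every $u\in V\setminus\{s,t\}$, contracting the tensors along the edges gives a linear map $\beta(\mathcal N;\mathcal T):\bigotimes_{e\in E(s)}\mathbb C^{d_e}\to\bigotimes_{e\in E(t)}\mathbb C^{d_e}$: its matrix entry at $(j,i)$ is $\sum_{\ell}\prod_{u\ne s,t}\mathcal T_u(\ell|_{E(u)})$, the sum running over all labellings $\ell$ of the edges, $\ell(e)\in\{1,\dots,d_e\}$, with $\ell|_{E(s)}=i$ and $\ell|_{E(t)}=j$. Let $\widetilde{QMF}(\mathcal N)$ be the maximum rank of $\beta(\mathcal N;\mathcal T)$ over all assignments $\mathcal T=(\mathcal T_u)_{u\in V\setminus\{s,t\}}$. Let $QMC(\mathcal N)$ be the minimum, over all partitions $V=\bar S\cup\bar T$ with $s\in\bar S$ and $t\in\bar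 T$, of the product of $d_e$ over all edges $e$ with one endpoint in $\bar S$ and the other in $\bar T$. For a positive integer $n$ let $n\mathcal N=(G,nd,s,t)$ be the network with every edge dimension multiplied by $n$. Then, for every such $\mathcal N$, $$\lim_{n\to\infty}\frac{\widetilde{QMF}(n\mathcal N)}{QMC(n\mathcal N)}=1.$$ -/

import Mathlib

open Filter Topology

/-- A quantum tensor network on a vertex set `V`: an undirected graph whose edges carry dimensions
`d_e ≥ 2`, with a source vertex and a sink vertex that are distinct. -/
structure TensorNetwork (V : Type*) where
  graph : SimpleGraph V
  dim : graph.edgeSet → ℕ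
  two_le_dim : ∀ e, 2 ≤ dim e
  source : V
  sink : V
  source_ne_sink : source ≠ sink

namespace TensorNetwork

variable {V : Type*}

/-- The network `nN`: every edge dimension is multiplied by the positive integer `n`. -/
def scale (n : ℕ+) (N : TensorNetwork V) : TensorNetwork V where
  graph := N.graph
  dim e := (n : ℕ) * N.dim e
  two_le_dim e := (N.two_le_dim e).trans (Nat.le_mul_of_pos_left _ n.pos)
  source := N.source
  sink := N.sink
  source_ne_sink := N.source_ne_sink

/-- The set `E(u)` of edges containing the vertex `u`. -/
abbrev EdgesAt (N : TensorNetwork V) (u : V) : Type _ :=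
  {e : N.graph.edgeSet // u ∈ (e : Sym2 V)}

/-- The index set of the standard basis of `⨂_{e ∈ E(u)} ℂ^{d_e}`. -/
abbrev Index (N : TensorNetwork V) (u : V) : Type _ :=
  (e : N.EdgesAt u) → Fin (N.dim e.1)

/-- The tensor space `⨂_{e ∈ E(u)} ℂ^{d_e}`, in coordinates for its standard basis. -/
abbrev TensorSpace (N : TensorNetwork V) (u : V) : Type _ :=
  N.Index u → ℂ

/-- The vertices different from the source and the sink. -/
abbrev InnerVertex (N : TensorNetwork V) : Type _ :=
  {u : V // u ≠ N.source ∧ u ≠ N.sink}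

/-- A tensor assignment: an arbitrary tensor at each vertex other than the source and the sink. -/
abbrev Assignment (N : TensorNetwork V) : Type _ :=
  (u : N.InnerVertex) → N.TensorSpace u

/-- A labelling of every edge `e` by a basis index of `ℂ^{d_e}`. -/
abbrev Labelling (N : TensorNetwork V) : Type _ :=
  (e : N.graph.edgeSet) → Fin (N.dim e)

/-- The labels that a labelling gives to the edges containing `u`. -/
def Labelling.at {N : TensorNetwork V} (l : N.Labelling) (u : V) : N.Index u :=
  fun e => l e.1

noncomputable section

variable [Fintype V]

open scoped Classical in
/-- The matrix of the contracted network: the entry at `(j, i)` is the sum, over all labellings of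
the edges that restrict to `i` at the source and to `j` at the sink, of the product of the
corresponding entries of the tensors. (An edge joining the source to the sink directly thus
contributes an identity map.) -/
def contractionMatrix (N : TensorNetwork V) (T : N.Assignment) :
    Matrix (N.Index N.sink) (N.Index N.source) ℂ :=
  Matrix.of fun j i =>
    ∑ l : N.Labelling,
      if l.at N.source = i ∧ l.at N.sink = j then ∏ u : N.InnerVertex, T u (l.at u) else 0

open scoped Classical in
/-- The linear map `β(N; T) : V(S) → V(T)` obtained by contracting all internal edges. -/
def contraction (N : TensorNetwork V) (T : N.Assignment) :
    N.TensorSpace N.source →ₗ[ℂ] N.TensorSpace N.sink :=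
  Matrix.toLin' (N.contractionMatrix T)

/-- The quantum max-flow: the maximum rank of `β(N; T)` over all tensor assignments `T`. -/
def maxFlow (N : TensorNetwork V) : ℕ :=
  sSup {r : ℕ | ∃ T : N.Assignment, r = Module.finrank ℂ (LinearMap.range (N.contraction T))}

/-- The maximum that defines `maxFlow` is attained. -/
theorem isGreatest_maxFlow (N : TensorNetwork V) :
    IsGreatest {r : ℕ | ∃ T : N.Assignment,
      r = Module.finrank ℂ (LinearMap.range (N.contraction T))} N.maxFlow := by
  classical
  have hb : BddAbove {r : ℕ | ∃ T : N.Assignment,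
      r = Module.finrank ℂ (LinearMap.range (N.contraction T))} := by
    refine ⟨Module.finrank ℂ (N.TensorSpace N.sink), ?_⟩
    rintro r ⟨T, rfl⟩
    exact Submodule.finrank_le _
  exact ⟨Nat.sSup_mem ⟨_, 0, rfl⟩ hb, fun r hr => le_csSup hb hr⟩

/-- An edge belongs to the cut set of `A ∪ Aᶜ` when one endpoint is in `A` and the other is not. -/
def Crosses (A : Set V) (e : Sym2 V) : Prop :=
  ∃ u v : V, e = s(u, v) ∧ u ∈ A ∧ v ∉ A

open scoped Classical in
/-- The capacity of the cut `A ∪ Aᶜ`: the product of the dimensions of the edges in its cut set. -/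
def cutCapacity (N : TensorNetwork V) (A : Set V) : ℕ :=
  ∏ e ∈ Finset.univ.filter (fun e : N.graph.edgeSet => Crosses A (e : Sym2 V)), N.dim e

/-- The quantum min-cut: the minimum capacity of a cut `A ∪ Aᶜ` with the source in `A` and the sink
in `Aᶜ`. -/
def minCut (N : TensorNetwork V) : ℕ :=
  sInf {c : ℕ | ∃ A : Set V, N.source ∈ A ∧ N.sink ∉ A ∧ c = N.cutCapacity A}

/-- The minimum that defines `minCut` is attained. -/
theorem isLeast_minCut (N : TensorNetwork V) :
    IsLeast {c : ℕ | ∃ A : Set V, N.source ∈ A ∧ N.sink ∉ A ∧ c = N.cutCapacity A} N.minCut := by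
  refine ⟨Nat.sInf_mem ⟨_, {N.source}, rfl, ?_, rfl⟩, fun c hc => Nat.sInf_le hc⟩
  exact fun h => N.source_ne_sink (Set.mem_singleton_iff.mp h).symm

end

end TensorNetwork

/-! The contraction factors through the edges of any cut, so its rank is at most `minCut`. For the
lower bound, let each walk `S` of a family from source to sink carry an index with `q S` values,
copied along the walk by the tensors. If the product of `q S` over the walks through `e` is at most
`dim e` for every `e`, the contraction contains an identity matrix of size `∏ q S`
(`prod_le_maxFlow`).

After taking logarithms this is a flow problem with capacities `L + δ e`, where `L = log n` and `δ e
= log (dim e)`. Max-flow min-cut gives a real flow `f`, and `q S = ⌊exp (f S)⌋₊` loses a factor at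
least `1 - exp (-f S)` on each walk. The loss disappears in the limit if all walks of a family
independent of `n` carry at least `η * L`.

Such a flow is built in `exists_large_walk_flow`. For large `L` the cheapest cuts have the fewest
edges; call these the minimum cuts. Forward walks never re-enter one, so they cross each exactly
once. Reserving `η * L` on every forward walk lowers all minimum cuts by the same amount, while
other cuts have slack of order `L`. The rest of the flow must also use forward walks only, so
forbidding the other darts must create no cheaper cut: `IsMinCut.card_le_card_forward` and
`IsMinCut.of_card_forward`. -/

/-! ### Walks and their edge sets -/

open scoped Classical in
/-- `Reach A s v S`: some walk from `s` to `v` through the darts allowed by `A` has edge set `S`. -/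
inductive Reach {V E : Type*} (A : E → V → V → Prop) (s : V) : V → Finset E → Prop
  | nil : Reach A s s ∅
  | step {u v : V} {e : E} {S : Finset E} : Reach A s u S → A e u v → Reach A s v (insert e S)

theorem Reach.mono {V E : Type*} {A B : E → V → V → Prop} (h : ∀ e u v, A e u v → B e u v)
    {s v : V} {S : Finset E} (hS : Reach A s v S) : Reach B s v S := by
  induction hS with
  | nil => exact .nil
  | step _ ha ih => exact .step ih (h _ _ _ ha)

/-- The edges with an allowed dart leaving `U`. -/
def outEdges {V E : Type*} (A : E → V → V → Prop) (U : Set V) : Set E :=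
  {e | ∃ u ∈ U, ∃ v ∉ U, A e u v}

open scoped Classical in
theorem Reach.exists_mem_outEdges {V E : Type*} {A : E → V → V → Prop} {s v : V} {S : Finset E}
    (hS : Reach A s v S) {U : Set V} (hs : s ∈ U) (hv : v ∉ U) : ∃ e ∈ S, e ∈ outEdges A U := by
  induction hS with
  | nil => exact absurd hs hv
  | @step u v e S _ ha ih =>
    by_cases hu : u ∈ U
    · exact ⟨e, Finset.mem_insert_self _ _, u, hu, v, hv, ha⟩
    · obtain ⟨e', h1, h2⟩ := ih hu
      exact ⟨e', Finset.mem_insert_of_mem h1, h2⟩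

-- Propagates a vertex property along a walk and on to its edges; used to show that a copied index
-- is constant along its walk.
open scoped Classical in
theorem Reach.forall_of_step {V E : Type*} {A : E → V → V → Prop} {s v : V} {S : Finset E}
    (hS : Reach A s v S) {Q : V → Prop} (hs : Q s) (h : ∀ e ∈ S, ∀ u v, A e u v → Q u → Q v) :
    Q v ∧ ∀ e ∈ S, ∃ u v, A e u v ∧ Q v := by
  induction hS with
  | nil => exact ⟨hs, by simp⟩
  | @step u v e S _ ha ih =>
    obtain ⟨h1, h2⟩ := ih fun e' he' => h e' (Finset.mem_insert_of_mem he')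
    have h3 := h e (Finset.mem_insert_self _ _) u v ha h1
    refine ⟨h3, fun e' he' => ?_⟩
    rcases Finset.mem_insert.1 he' with rfl | he'
    · exact ⟨u, v, ha, h3⟩
    · exact h2 e' he'

/-! ### Max-flow min-cut by linear duality -/

section Duality

variable {V E : Type*} [Fintype V] [Fintype E] {A : E → V → V → Prop} {s t : V}

open scoped Classical in
/-- A potential rising by at most `y e` along the darts of `e` is charged by the capacities of its
level cuts. -/
theorem mul_le_sum_of_potential
    (hA : ∀ e u v u' v', A e u v → A e u' v' → (u' = u ∧ v' = v) ∨ (u' = v ∧ v' = u))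
    {c y : E → ℝ} (hc : ∀ e, 0 ≤ c e) (hy : ∀ e, 0 ≤ y e) {F D : ℝ} (hD : 0 ≤ D)
    (hcut : ∀ U : Set V, s ∈ U → t ∉ U → F ≤ ∑ e with e ∈ outEdges A U, c e)
    (φ : V → ℝ) (hs : φ s = 0) (ht : φ t = D) (hφ : ∀ e u v, A e u v → φ v ≤ φ u + y e) :
    F * D ≤ ∑ e, c e * y e := by
  -- `[a e, b e)` contains the thresholds at which `e` leaves the sublevel set. At most one
  -- orientation of `e` raises `φ`; if none does, the interval is empty.
  have hab : ∀ e, ∃ a b : ℝ, a ≤ b ∧ b ≤ a + y e ∧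
      ∀ u v, A e u v → φ u < φ v → a = φ u ∧ b = φ v := by
    intro e
    by_cases h : ∃ u v, A e u v ∧ φ u < φ v
    · obtain ⟨u, v, h1, h2⟩ := h
      refine ⟨φ u, φ v, h2.le, hφ _ _ _ h1, fun u' v' h3 h4 => ?_⟩
      rcases hA _ _ _ _ _ h1 h3 with ⟨rfl, rfl⟩ | ⟨rfl, rfl⟩
      · exact ⟨rfl, rfl⟩
      · exact absurd h4 h2.asymm
    · push Not at h
      exact ⟨0, 0, le_rfl, by simpa using hy e, fun u v h1 h2 => absurd h2 (h u v h1).not_gt⟩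
  choose a b hab hby habφ using hab
  -- Each sublevel set `{φ ≤ θ}` with `0 ≤ θ < D` is a cut; integrating over `θ` gives the claim.
  have key : ∀ θ ∈ Set.Ico 0 D,
      F ≤ ∑ e, (Set.Ico (a e) (b e)).indicator (fun _ => c e) θ := by
    intro θ hθ
    refine (hcut {v | φ v ≤ θ} (by simpa [hs] using hθ.1) (by simpa [ht] using hθ.2)).trans ?_
    rw [Finset.sum_filter]
    refine Finset.sum_le_sum fun e _ => ?_
    split_ifs with h
    · obtain ⟨u, hu, v, hv, h1⟩ := h
      simp only [Set.mem_ofPred_eq, not_le] at hu hv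
      obtain ⟨h2, h3⟩ := habφ e u v h1 (hu.trans_lt hv)
      rw [Set.indicator_of_mem]
      rw [h2, h3]
      exact ⟨hu, hv⟩
    · exact Set.indicator_nonneg (fun _ _ => hc e) _
  have hint : ∀ e, MeasureTheory.Integrable
      ((Set.Ico (a e) (b e)).indicator (fun _ => c e)) := fun e =>
    (MeasureTheory.integrable_indicator_iff measurableSet_Ico).2
      (MeasureTheory.integrableOn_const (by simp) (by simp))
  have hsum : MeasureTheory.Integrable
      (fun θ => ∑ e, (Set.Ico (a e) (b e)).indicator (fun _ => c e) θ) :=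
    MeasureTheory.integrable_finsetSum _ fun e _ => hint e
  calc F * D = ∫ _ in Set.Ico 0 D, F := by simp [hD, mul_comm]
    _ ≤ ∫ θ in Set.Ico 0 D, ∑ e, (Set.Ico (a e) (b e)).indicator (fun _ => c e) θ :=
        MeasureTheory.setIntegral_mono_on (MeasureTheory.integrableOn_const (by simp) (by simp))
          hsum.integrableOn measurableSet_Ico key
    _ ≤ ∫ θ, ∑ e, (Set.Ico (a e) (b e)).indicator (fun _ => c e) θ :=
        MeasureTheory.setIntegral_le_integral hsum (Filter.Eventually.of_forall fun θ =>
          Finset.sum_nonneg fun e _ => Set.indicator_nonneg (fun _ _ => hc e) _)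
    _ = ∑ e, c e * (b e - a e) := by
        rw [MeasureTheory.integral_finsetSum _ fun e _ => hint e]
        refine Finset.sum_congr rfl fun e _ => ?_
        rw [MeasureTheory.integral_indicator measurableSet_Ico]
        simp [hab e, mul_comm]
    _ ≤ _ := Finset.sum_le_sum fun e _ =>
        mul_le_mul_of_nonneg_left (by linarith [hby e]) (hc e)

open scoped Classical in
/-- If every cut has capacity at least `F`, then for any edge lengths `y` some walk from `s` to `t`
has length at most `(∑ c y) / F`. -/
theorem exists_short_walk
    (hA : ∀ e u v u' v', A e u v → A e u' v' → (u' = u ∧ v' = v) ∨ (u' = v ∧ v' = u))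
    {c y : E → ℝ} (hc : ∀ e, 0 ≤ c e) (hy : ∀ e, 0 ≤ y e) {F : ℝ} (hF : 0 < F)
    (hcut : ∀ U : Set V, s ∈ U → t ∉ U → F ≤ ∑ e with e ∈ outEdges A U, c e) :
    ∃ S, Reach A s t S ∧ F * ∑ e ∈ S, y e ≤ ∑ e, c e * y e := by
  have hne : ∃ S, Reach A s t S := by
    by_contra h
    refine (hcut {v | ∃ S, Reach A s v S} ⟨∅, .nil⟩ h).not_gt ?_
    rw [Finset.sum_eq_zero]
    · exact hF
    · intro e he
      obtain ⟨u, ⟨S, hS⟩, v, hv, h1⟩ := (Finset.mem_filter.1 he).2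
      exact absurd ⟨_, hS.step h1⟩ hv
  obtain ⟨S₀, hS₀, hmin⟩ := Set.exists_min_image {S | Reach A s t S} (fun S => ∑ e ∈ S, y e)
    (Set.toFinite _) hne
  refine ⟨S₀, hS₀, ?_⟩
  set D := ∑ e ∈ S₀, y e with hDdef
  have hlen : ∀ S : Finset E, 0 ≤ ∑ e ∈ S, y e := fun S => Finset.sum_nonneg fun e _ => hy e
  -- The potential is the distance from `s` truncated at `D`. Inserting `D` also gives a value to
  -- unreachable vertices.
  let X : V → Set ℝ := fun v => insert D ((fun S => ∑ e ∈ S, y e) '' {S | Reach A s v S})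
  have hfin : ∀ v, (X v).Finite := fun v => ((Set.toFinite _).image _).insert _
  have hX : ∀ v, (X v).Nonempty := fun v => ⟨D, Set.mem_insert _ _⟩
  have hmem : ∀ v, sInf (X v) ∈ X v := fun v => (hX v).csInf_mem (hfin v)
  have hle : ∀ v, ∀ x ∈ X v, sInf (X v) ≤ x := fun v x hx => csInf_le (hfin v).bddBelow hx
  have h0 : ∀ v, ∀ x ∈ X v, 0 ≤ x := by
    rintro v x (rfl | ⟨S, _, rfl⟩)
    · exact hlen _
    · exact hlen _
  refine mul_le_sum_of_potential hA hc hy (hlen S₀) hcut (fun v => sInf (X v)) ?_ ?_ ?_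
  · exact le_antisymm (hle s 0 (Set.mem_insert_of_mem _ ⟨∅, .nil, by simp⟩)) (h0 s _ (hmem s))
  · refine le_antisymm (hle t D (Set.mem_insert _ _)) (le_csInf (hX t) ?_)
    rintro x (rfl | ⟨S, hS, rfl⟩)
    · exact le_rfl
    · exact hmin S hS
  · intro e u v h1
    rcases hmem u with h | ⟨S, hS, h⟩
    · rw [h]
      linarith [hle v D (Set.mem_insert _ _), hy e]
    · dsimp only at h ⊢
      rw [← h]
      refine (hle v _ (Set.mem_insert_of_mem _ ⟨_, Reach.step hS h1, rfl⟩)).trans ?_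
      dsimp only
      by_cases he : e ∈ S
      · rw [Finset.insert_eq_of_mem he]
        linarith [hy e]
      · rw [Finset.sum_insert he, add_comm]

open scoped Classical in
/-- Max-flow at least min-cut, with the flow given as a weighting of walks. -/
theorem exists_walk_flow
    (hA : ∀ e u v u' v', A e u v → A e u' v' → (u' = u ∧ v' = v) ∨ (u' = v ∧ v' = u))
    {c : E → ℝ} (hc : ∀ e, 0 ≤ c e) {F : ℝ} (hF : 0 ≤ F)
    (hcut : ∀ U : Set V, s ∈ U → t ∉ U → F ≤ ∑ e with e ∈ outEdges A U, c e) :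
    ∃ f : Finset E → ℝ, (∀ S, 0 ≤ f S) ∧ (∀ S, f S ≠ 0 → Reach A s t S) ∧ ∑ S, f S = F ∧
      ∀ e, ∑ S with e ∈ S, f S ≤ c e := by
  rcases hF.eq_or_lt with rfl | hF
  · exact ⟨0, by simp, by simp, by simp, by simpa using hc⟩
  -- `K` is the set of probability distributions on walks, and `Λ` sends one to the edge loads of
  -- the corresponding flow of value `F`. If no load is below `c`, a separating functional yields
  -- edge lengths that contradict `exists_short_walk`.
  let K : Set (Finset E → ℝ) := stdSimplex ℝ (Finset E) ∩ {f | ∀ S, ¬ Reach A s t S → f S = 0}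
  let Λ : (Finset E → ℝ) →L[ℝ] (E → ℝ) :=
    ContinuousLinearMap.pi fun e => ∑ S with e ∈ S, F • ContinuousLinearMap.proj S
  have hΛ : ∀ f e, Λ f e = ∑ S with e ∈ S, F * f S := by
    intro f e
    simp [Λ]
  have hZ : {f : Finset E → ℝ | ∀ S, ¬ Reach A s t S → f S = 0} =
      ⋂ S, ⋂ (_ : ¬ Reach A s t S), {f | f S = 0} := by
    ext
    simp
  have hKcpt : IsCompact K := by
    refine (isCompact_stdSimplex ℝ _).inter_right ?_
    rw [hZ]
    exact isClosed_iInter fun S => isClosed_iInter fun _ =>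
      isClosed_eq (continuous_apply S) continuous_const
  have hKconv : Convex ℝ K := by
    refine (convex_stdSimplex ℝ _).inter ?_
    intro f hf g hg α β _ _ _ S hS
    simp [hf S hS, hg S hS]
  by_cases hdisj : Disjoint (Λ '' K) (Set.Iic c)
  · exfalso
    obtain ⟨g, u, v, h1, huv, h2⟩ := geometric_hahn_banach_compact_closed
      (hKconv.linear_image Λ.toLinearMap) (hKcpt.image Λ.continuous) (convex_Iic c)
      isClosed_Iic hdisj
    let y : E → ℝ := fun e => - g (Pi.single e 1)
    have hg : ∀ w : E → ℝ, g w = - ∑ e, w e * y e := by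
      intro w
      conv_lhs => rw [← Finset.univ_sum_single w]
      rw [map_sum, ← Finset.sum_neg_distrib]
      refine Finset.sum_congr rfl fun e _ => ?_
      have : Pi.single e (w e) = w e • (Pi.single e 1 : E → ℝ) := by
        rw [← Pi.single_smul]
        simp
      rw [this, map_smul]
      simp [y]
    have hy : ∀ e, 0 ≤ y e := by
      intro e
      by_contra hneg
      push Not at hneg
      -- Lowering coordinate `e` of `c` by this `M` stays in the orthant but brings `g` down to `v`
      -- or below.
      let M : ℝ := max 0 ((g c - v) / - y e)
      have h3 := h2 (c + (-M) • Pi.single e 1) (by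
        intro e'
        have : 0 ≤ M * (Pi.single e 1 : E → ℝ) e' :=
          mul_nonneg (le_max_left _ _) (by
            rw [Pi.single_apply]
            split_ifs <;> norm_num)
        simp only [Pi.add_apply, Pi.smul_apply, smul_eq_mul]
        linarith)
      rw [map_add, map_smul] at h3
      have h4 : (g c - v) / - y e ≤ M := le_max_right _ _
      rw [div_le_iff₀ (by linarith)] at h4
      have h5 : g (Pi.single e 1) = - y e := by simp [y]
      rw [h5, smul_eq_mul] at h3
      linarith
    obtain ⟨S, hS, h3⟩ := exists_short_walk hA hc hy hF hcut
    have h4 := h1 (Λ (Pi.single S 1)) ⟨_, ⟨single_mem_stdSimplex ℝ S, fun S' hS' => by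
      rw [Pi.single_eq_of_ne]
      rintro rfl
      exact hS' hS⟩, rfl⟩
    have h5 := h2 c Set.self_mem_Iic
    rw [hg] at h4 h5
    have h6 : ∑ e, Λ (Pi.single S 1) e * y e = F * ∑ e ∈ S, y e := by
      simp [hΛ, Finset.mul_sum, Pi.single_apply]
    linarith
  · obtain ⟨_, ⟨f, hf, rfl⟩, hfc⟩ := Set.not_disjoint_iff.1 hdisj
    refine ⟨fun S => F * f S, fun S => mul_nonneg hF.le (hf.1.1 S), fun S hS => ?_, ?_, ?_⟩
    · by_contra h
      exact hS (by simp [hf.2 S h])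
    · rw [← Finset.mul_sum, hf.1.2, mul_one]
    · intro e
      rw [← hΛ]
      exact hfc e

end Duality

/-! ### Minimum cuts, forward darts and flows with large parts -/

section MinimumCuts

variable {V E : Type*}

/-- The edge `e` joins `u` to `v`. -/
def Joins (ends : E → Sym2 V) (e : E) (u v : V) : Prop := ends e = s(u, v)

theorem Joins.symm {ends : E → Sym2 V} {e : E} {u v : V} (h : Joins ends e u v) :
    Joins ends e v u := by
  rw [Joins, Sym2.eq_swap]
  exact h

theorem Joins.unique {ends : E → Sym2 V} {e : E} {u v u' v' : V} (h : Joins ends e u v)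
    (h' : Joins ends e u' v') : (u' = u ∧ v' = v) ∨ (u' = v ∧ v' = u) := by
  rw [Joins] at h h'
  rw [h, Sym2.eq_iff] at h'
  tauto

theorem Joins.mem_left {ends : E → Sym2 V} {e : E} {u v : V} (h : Joins ends e u v) :
    u ∈ ends e := by
  rw [h]
  exact Sym2.mem_mk_left _ _

variable [Fintype E]

open scoped Classical in
/-- The edges with an allowed dart leaving `U`, as a finset. -/
noncomputable def outFinset (A : E → V → V → Prop) (U : Set V) : Finset E :=
  {e | e ∈ outEdges A U}

theorem mem_outFinset {A : E → V → V → Prop} {U : Set V} {e : E} :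
    e ∈ outFinset A U ↔ ∃ u ∈ U, ∃ v ∉ U, A e u v := by
  simp only [outFinset, Finset.mem_filter, Finset.mem_univ, true_and]
  rfl

/-- `U` separates `s` from `t` and is crossed by as few edges as possible. -/
def IsMinCut (ends : E → Sym2 V) (s t : V) (U : Set V) : Prop :=
  s ∈ U ∧ t ∉ U ∧ ∀ W : Set V, s ∈ W → t ∉ W →
    (outFinset (Joins ends) U).card ≤ (outFinset (Joins ends) W).card

/-- The darts that do not enter any minimum cut from outside. -/
def Forward (ends : E → Sym2 V) (s t : V) (e : E) (u v : V) : Prop :=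
  Joins ends e u v ∧ ∀ W, IsMinCut ends s t W → v ∈ W → u ∈ W

variable {ends : E → Sym2 V} {s t : V}

theorem exists_isMinCut (hst : s ≠ t) : ∃ U, IsMinCut ends s t U := by
  obtain ⟨U, hU, hmin⟩ := exists_minimalFor_of_wellFoundedLT (fun U : Set V => s ∈ U ∧ t ∉ U)
    (fun U => (outFinset (Joins ends) U).card) ⟨{s}, rfl, fun h => hst h.symm⟩
  refine ⟨U, hU.1, hU.2, fun W h1 h2 => ?_⟩
  by_contra h
  exact h (hmin ⟨h1, h2⟩ (not_le.1 h).le)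

open scoped Classical in
/-- Along a forward walk each minimum cut is crossed at most once. -/
theorem Reach.card_inter_of_forward {W : Set V} (hW : IsMinCut ends s t W) {v : V} {S : Finset E}
    (hS : Reach (Forward ends s t) s v S) :
    (v ∈ W → S ∩ outFinset (Joins ends) W = ∅) ∧
      (v ∉ W → (S ∩ outFinset (Joins ends) W).card = 1) := by
  induction hS with
  | nil => exact ⟨fun _ => by simp, fun h => absurd hW.1 h⟩
  | @step u v e S _ ha ih =>
    by_cases hu : u ∈ W
    · by_cases hv : v ∈ W
      · refine ⟨fun _ => ?_, fun h => absurd hv h⟩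
        rw [Finset.insert_inter_of_notMem, ih.1 hu]
        intro he
        obtain ⟨a, h1, b, h2, h3⟩ := mem_outFinset.1 he
        rcases Joins.unique ha.1 h3 with ⟨rfl, rfl⟩ | ⟨rfl, rfl⟩ <;> contradiction
      · refine ⟨fun h => absurd h hv, fun _ => ?_⟩
        rw [Finset.insert_inter_of_mem (mem_outFinset.2 ⟨u, hu, v, hv, ha.1⟩), ih.1 hu]
        simp
    · have hv : v ∉ W := fun hv => hu (ha.2 W hW hv)
      refine ⟨fun h => absurd h hv, fun _ => ?_⟩
      rw [Finset.insert_inter_of_notMem, ih.2 hu]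
      intro he
      obtain ⟨a, h1, b, h2, h3⟩ := mem_outFinset.1 he
      rcases Joins.unique ha.1 h3 with ⟨rfl, rfl⟩ | ⟨rfl, rfl⟩ <;> contradiction

open scoped Classical in
/-- A walk crossing each minimum cut at most once leaves every `U` through a forward dart. -/
theorem Reach.exists_mem_outFinset_forward {S₀ : Finset E} {U : Set V} (hs : s ∈ U)
    (hS₀ : ∀ W, IsMinCut ends s t W → (S₀ ∩ outFinset (Joins ends) W).card ≤ 1)
    (hU : ∀ e ∈ S₀, e ∉ outFinset (Forward ends s t) U) {v : V} {S : Finset E}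
    (hS : Reach (Joins ends) s v S) (hsub : S ⊆ S₀) :
    v ∈ U ∧ ∀ e ∈ S, ∀ u ∈ ends e, u ∈ U := by
  induction hS with
  | nil => exact ⟨hs, by simp⟩
  | @step u v e S hr ha ih =>
    obtain ⟨hu, hS⟩ := ih ((Finset.subset_insert _ _).trans hsub)
    have he := hsub (Finset.mem_insert_self _ _)
    have hv : v ∈ U := by
      by_contra hv
      have h1 : ¬ Forward ends s t e u v := fun h => hU e he (mem_outFinset.2 ⟨u, hu, v, hv, h⟩)
      simp only [Forward, ha, true_and, not_forall] at h1
      obtain ⟨W, hW, hvW, huW⟩ := h1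
      obtain ⟨e', h2, h3⟩ := hr.exists_mem_outEdges hW.1 huW
      -- All earlier edges have both ends in `U`, whereas `v` lies outside. So `e` and `e'` would be
      -- two edges of the walk crossing `W`.
      have h4 : e ≠ e' := by
        rintro rfl
        exact hv (hS e h2 v ha.symm.mem_left)
      refine h4 (Finset.card_le_one.1 (hS₀ W hW) e ?_ e' ?_)
      · exact Finset.mem_inter.2 ⟨he, mem_outFinset.2 ⟨v, hvW, u, huW, ha.symm⟩⟩
      · exact Finset.mem_inter.2 ⟨hsub (Finset.mem_insert_of_mem h2), mem_outFinset.2 h3⟩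
    refine ⟨hv, fun e' he' w hw => ?_⟩
    rcases Finset.mem_insert.1 he' with rfl | he'
    · rw [ha, Sym2.mem_iff] at hw
      rcases hw with rfl | rfl <;> assumption
    · exact hS e' he' w hw

open scoped Classical in
/-- A forward walk that enters `U` from outside meets the forward boundary of `U` twice: once
before and once after crossing the minimum cut `W`. -/
theorem Reach.reenter_of_forward {U W : Set V} (hs : s ∈ U) (hW : IsMinCut ends s t W) {a b : V}
    {e₀ : E} (haU : a ∈ U) (haW : a ∉ W) (hbU : b ∉ U) (hbW : b ∈ W) (he₀ : Joins ends e₀ b a)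
    {v : V} {S : Finset E} (hS : Reach (Forward ends s t) s v S) :
    (v ∉ U → v ∈ W → ∃ e ∈ S ∩ outFinset (Forward ends s t) U, ∀ u ∈ ends e, u ∈ W) ∧
    (e₀ ∈ S → v ∉ W ∧ ∃ e ∈ S ∩ outFinset (Forward ends s t) U, ∀ u ∈ ends e, u ∈ W) ∧
    (e₀ ∈ S → v ∉ U → ∃ e ∈ S ∩ outFinset (Forward ends s t) U, ∃ u ∈ ends e, u ∉ W) := by
  induction hS with
  | nil => exact ⟨fun h => absurd hs h, by simp, by simp⟩
  | @step u v e S _ ha ih =>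
    obtain ⟨ih1, ih2, ih3⟩ := ih
    have hsub : S ∩ outFinset (Forward ends s t) U ⊆
        insert e S ∩ outFinset (Forward ends s t) U :=
      Finset.inter_subset_inter_right (Finset.subset_insert _ _)
    have hnew : u ∈ U → v ∉ U → e ∈ insert e S ∩ outFinset (Forward ends s t) U := fun hu hv =>
      Finset.mem_inter.2 ⟨Finset.mem_insert_self _ _, mem_outFinset.2 ⟨u, hu, v, hv, ha⟩⟩
    have hclosed : u ∉ W → v ∉ W := fun h h' => h (ha.2 W hW h')
    have hfirst : e = e₀ → u = b ∧ v = a := by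
      rintro rfl
      rcases Joins.unique ha.1 he₀ with ⟨rfl, rfl⟩ | ⟨rfl, rfl⟩
      · exact ⟨rfl, rfl⟩
      · exact absurd (ha.2 W hW hbW) haW
    refine ⟨fun hvU hvW => ?_, fun he => ?_, fun he hvU => ?_⟩
    · have huW := ha.2 W hW hvW
      by_cases hu : u ∈ U
      · refine ⟨e, hnew hu hvU, fun w hw => ?_⟩
        rw [ha.1, Sym2.mem_iff] at hw
        rcases hw with rfl | rfl <;> assumption
      · obtain ⟨e', h1, h2⟩ := ih1 hu huW
        exact ⟨e', hsub h1, h2⟩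
    · by_cases heS : e₀ ∈ S
      · obtain ⟨h0, e', h1, h2⟩ := ih2 heS
        exact ⟨hclosed h0, e', hsub h1, h2⟩
      · obtain ⟨rfl, rfl⟩ := hfirst (by
          rcases Finset.mem_insert.1 he with h | h
          · exact h.symm
          · exact absurd h heS)
        obtain ⟨e', h1, h2⟩ := ih1 hbU hbW
        exact ⟨haW, e', hsub h1, h2⟩
    · by_cases heS : e₀ ∈ S
      · by_cases hu : u ∈ U
        · exact ⟨e, hnew hu hvU, u, ha.1.mem_left, (ih2 heS).1⟩
        · obtain ⟨e', h1, h2⟩ := ih3 heS hu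
          exact ⟨e', hsub h1, h2⟩
      · obtain ⟨rfl, rfl⟩ := hfirst (by
          rcases Finset.mem_insert.1 he with h | h
          · exact h.symm
          · exact absurd h heS)
        exact absurd haU hvU

open scoped Classical in
theorem sum_mul_card_inter (f : Finset E → ℝ) (X : Finset E) :
    ∑ S, f S * (S ∩ X).card = ∑ e ∈ X, ∑ S with e ∈ S, f S := by
  simp_rw [Finset.sum_filter]
  rw [Finset.sum_comm]
  refine Finset.sum_congr rfl fun S _ => ?_
  rw [← Finset.sum_filter, Finset.sum_const, nsmul_eq_mul, mul_comm, Finset.filter_mem_eq_inter,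
    Finset.inter_comm]

open scoped Classical in
/-- A unit-capacity flow whose walks all meet `X` has value at most `#X`; in case of equality each
walk meets `X` exactly once and each edge of `X` is used. -/
theorem card_inter_of_unit_flow {f : Finset E → ℝ} (hf : ∀ S, 0 ≤ f S)
    (hload : ∀ e, ∑ S with e ∈ S, f S ≤ 1) {X : Finset E}
    (hX : ∀ S, f S ≠ 0 → ∃ e ∈ S, e ∈ X) :
    ∑ S, f S ≤ X.card ∧ (∑ S, f S = X.card →
      (∀ S, f S ≠ 0 → (S ∩ X).card = 1) ∧ ∀ e ∈ X, ∃ S, f S ≠ 0 ∧ e ∈ S) := by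
  have h1 : ∀ S ∈ (Finset.univ : Finset (Finset E)), f S ≤ f S * (S ∩ X).card := by
    intro S _
    by_cases h : f S = 0
    · simp [h]
    · obtain ⟨e, h2, h3⟩ := hX S h
      have : 1 ≤ (S ∩ X).card := Finset.card_pos.2 ⟨e, Finset.mem_inter.2 ⟨h2, h3⟩⟩
      exact le_mul_of_one_le_right (hf S) (by exact_mod_cast this)
  have h2 : ∀ e ∈ X, ∑ S with e ∈ S, f S ≤ 1 := fun e _ => hload e
  -- Double counting: `∑ f S ≤ ∑ f S * #(S ∩ X)`, which is the total load on `X`, at most `#X`.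
  -- Equality of the ends forces equality in every term.
  have h3 := Finset.sum_le_sum h1
  have h4 := Finset.sum_le_sum h2
  rw [sum_mul_card_inter] at h3
  rw [Finset.sum_const, nsmul_eq_mul, mul_one] at h4
  refine ⟨h3.trans h4, fun heq => ⟨fun S hS => ?_, fun e he => ?_⟩⟩
  · have h5 := (Finset.sum_eq_sum_iff_of_le h1).1
      (le_antisymm (Finset.sum_le_sum h1) (by rw [sum_mul_card_inter, heq]; exact h4))
      S (Finset.mem_univ _)
    have h6 : ((S ∩ X).card : ℝ) = 1 := by
      field_simp at h5
      exact h5.symm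
    exact_mod_cast h6
  · by_contra h
    push Not at h
    have h5 := (Finset.sum_eq_sum_iff_of_le h2).1
      (le_antisymm (Finset.sum_le_sum h2) (by simpa [← heq] using h3)) e he
    rw [Finset.sum_eq_zero] at h5
    · norm_num at h5
    · intro S hS
      by_contra h6
      exact h S h6 (Finset.mem_filter.1 hS).2

open scoped Classical in
theorem outFinset_def (A : E → V → V → Prop) (U : Set V) :
    outFinset A U = ({e | e ∈ outEdges A U} : Finset E) := rfl

variable [Fintype V]

open scoped Classical in
/-- Every cut has at least as many forward edges as a minimum cut has edges. -/
theorem IsMinCut.card_le_card_forward {W₀ U : Set V} (hW₀ : IsMinCut ends s t W₀) (hs : s ∈ U)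
    (ht : t ∉ U) : (outFinset (Joins ends) W₀).card ≤ (outFinset (Forward ends s t) U).card := by
  obtain ⟨f, hf, hr, hsum, hload⟩ := exists_walk_flow (A := Joins ends) (s := s) (t := t)
    (c := fun _ => 1) (F := (outFinset (Joins ends) W₀).card)
    (fun _ _ _ _ _ => Joins.unique) (fun _ => zero_le_one) (Nat.cast_nonneg _) (by
      intro U h1 h2
      rw [← outFinset_def, Finset.sum_const, nsmul_eq_mul, mul_one]
      exact_mod_cast hW₀.2.2 U h1 h2)
  -- Complementary slackness: a flow of minimum-cut value crosses each minimum cut once per walk.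
  have hone : ∀ S, f S ≠ 0 → ∀ W, IsMinCut ends s t W →
      (S ∩ outFinset (Joins ends) W).card ≤ 1 := by
    intro S hS W hW
    refine (((card_inter_of_unit_flow hf hload (X := outFinset (Joins ends) W) ?_).2 ?_).1
      S hS).le
    · intro S hS
      obtain ⟨e, h1, h2⟩ := (hr S hS).exists_mem_outEdges hW.1 hW.2.1
      exact ⟨e, h1, mem_outFinset.2 h2⟩
    · rw [hsum, le_antisymm (hW₀.2.2 W hW.1 hW.2.1) (hW.2.2 W₀ hW₀.1 hW₀.2.1)]
  have := (card_inter_of_unit_flow hf hload (X := outFinset (Forward ends s t) U) (by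
    intro S hS
    by_contra h
    push Not at h
    exact ht (Reach.exists_mem_outFinset_forward hs (hone S hS) h (hr S hS) subset_rfl).1)).1
  rw [hsum] at this
  exact_mod_cast this

open scoped Classical in
/-- A cut with as few forward edges as possible is a minimum cut. -/
theorem IsMinCut.of_card_forward {W₀ U : Set V} (hW₀ : IsMinCut ends s t W₀) (hs : s ∈ U)
    (ht : t ∉ U)
    (hU : (outFinset (Forward ends s t) U).card = (outFinset (Joins ends) W₀).card) :
    IsMinCut ends s t U ∧ outFinset (Forward ends s t) U = outFinset (Joins ends) U := by
  have hunique : ∀ e u v u' v', Forward ends s t e u v → Forward ends s t e u' v' →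
      (u' = u ∧ v' = v) ∨ (u' = v ∧ v' = u) := fun _ _ _ _ _ h h' => h.1.unique h'.1
  obtain ⟨f, hf, hr, hsum, hload⟩ := exists_walk_flow (A := Forward ends s t) (s := s) (t := t)
    (c := fun _ => 1) (F := (outFinset (Joins ends) W₀).card)
    hunique (fun _ => zero_le_one) (Nat.cast_nonneg _) (by
      intro U h1 h2
      rw [← outFinset_def, Finset.sum_const, nsmul_eq_mul, mul_one]
      exact_mod_cast hW₀.card_le_card_forward h1 h2)
  have hcard := ((card_inter_of_unit_flow hf hload (X := outFinset (Forward ends s t) U) (by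
    intro S hS
    obtain ⟨e, h1, h2⟩ := (hr S hS).exists_mem_outEdges hs ht
    exact ⟨e, h1, mem_outFinset.2 h2⟩)).2 (by rw [hsum, hU])).1
  have heq : outFinset (Forward ends s t) U = outFinset (Joins ends) U := by
    apply Finset.Subset.antisymm
    · intro e he
      obtain ⟨u, hu, v, hv, h⟩ := mem_outFinset.1 he
      exact mem_outFinset.2 ⟨u, hu, v, hv, h.1⟩
    · intro e he
      obtain ⟨a, haU, b, hbU, h⟩ := mem_outFinset.1 he
      by_contra hne
      have h1 : ¬ Forward ends s t e a b := fun h => hne (mem_outFinset.2 ⟨a, haU, b, hbU, h⟩)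
      simp only [Forward, h, true_and, not_forall] at h1
      obtain ⟨W, hW, hbW, haW⟩ := h1
      -- The flow saturates `W`, so some flow walk uses `e`, necessarily from `b` to `a`. It thus
      -- enters `U`, having left it inside `W`, and must leave it again beyond `W`: two forward
      -- boundary edges, where `hcard` allows one.
      obtain ⟨S, hS, heS⟩ := ((card_inter_of_unit_flow hf hload
        (X := outFinset (Joins ends) W) (by
          intro S hS
          obtain ⟨e, h1, h2⟩ := ((hr S hS).mono fun _ _ _ h => h.1).exists_mem_outEdges
            hW.1 hW.2.1
          exact ⟨e, h1, mem_outFinset.2 h2⟩)).2 (by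
        rw [hsum, le_antisymm (hW₀.2.2 W hW.1 hW.2.1) (hW.2.2 W₀ hW₀.1 hW₀.2.1)])).2 e
          (mem_outFinset.2 ⟨b, hbW, a, haW, h.symm⟩)
      obtain ⟨-, h2, h3⟩ := (hr S hS).reenter_of_forward hs hW haU haW hbU hbW h.symm
      obtain ⟨-, e₁, h4, h5⟩ := h2 heS
      obtain ⟨e₂, h6, w, hw, h7⟩ := h3 heS ht
      have : e₁ = e₂ := Finset.card_le_one.1 (hcard S hS).le e₁ h4 e₂ h6
      exact h7 (h5 w (this ▸ hw))
  refine ⟨⟨hs, ht, fun W h1 h2 => ?_⟩, heq⟩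
  rw [← heq, hU]
  exact hW₀.2.2 W h1 h2

open scoped Classical in
/-- For capacities `L + δ e` with `L` large there is a flow as large as the minimum cut in which
every walk of a fixed family carries at least `η * L`. -/
theorem exists_large_walk_flow (hst : s ≠ t) (δ : E → ℝ) (hδ : ∀ e, 0 ≤ δ e) :
    ∃ (P : Finset (Finset E)) (W : Set V) (η L₀ : ℝ), 0 < η ∧ s ∈ W ∧ t ∉ W ∧
      (∀ S ∈ P, Reach (Joins ends) s t S) ∧ ∀ L ≥ L₀, ∃ f : Finset E → ℝ,
        (∀ S ∈ P, η * L ≤ f S) ∧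
        ∑ S ∈ P, f S = ∑ e ∈ outFinset (Joins ends) W, (L + δ e) ∧
        ∀ e, ∑ S ∈ P with e ∈ S, f S ≤ L + δ e := by
  -- Among the cuts with fewest edges, `W` has the least `δ`-weight.
  obtain ⟨W, hW, hWmin⟩ := Set.exists_min_image {W | IsMinCut ends s t W}
    (fun W => ∑ e ∈ outFinset (Joins ends) W, δ e) (Set.toFinite _) (exists_isMinCut hst)
  set P : Finset (Finset E) := {S | Reach (Forward ends s t) s t S} with hP
  have hPmem : ∀ S, S ∈ P ↔ Reach (Forward ends s t) s t S := by simp [hP]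
  -- Small enough that the reserved flow costs any set of edges at most `L / 2` and leaves every
  -- capacity nonnegative.
  set η : ℝ := 1 / (2 * (Fintype.card E + 1) * (P.card + 1)) with hη
  have hη0 : 0 < η := by positivity
  have hηE : η * (Fintype.card E * P.card) ≤ 1 / 2 := by
    rw [hη, div_mul_eq_mul_div, one_mul, div_le_div_iff₀ (by positivity) (by positivity)]
    nlinarith [(Nat.cast_nonneg (Fintype.card E) : (0:ℝ) ≤ _),
      (Nat.cast_nonneg P.card : (0:ℝ) ≤ _)]
  have hηP : η * P.card ≤ 1 / 2 := by
    rw [hη, div_mul_eq_mul_div, one_mul, div_le_div_iff₀ (by positivity) (by positivity)]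
    nlinarith [(Nat.cast_nonneg (Fintype.card E) : (0:ℝ) ≤ _),
      (Nat.cast_nonneg P.card : (0:ℝ) ≤ _), mul_nonneg (Nat.cast_nonneg (Fintype.card E) : (0:ℝ) ≤ _)
      (Nat.cast_nonneg P.card : (0:ℝ) ≤ _)]
  set D := ∑ e ∈ outFinset (Joins ends) W, δ e with hD
  have hD0 : 0 ≤ D := Finset.sum_nonneg fun e _ => hδ e
  refine ⟨P, W, η, 2 * D, hη0, hW.1, hW.2.1, fun S hS => ((hPmem S).1 hS).mono fun _ _ _ h => h.1,
    fun L hL => ?_⟩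
  have hL0 : 0 ≤ L := by linarith
  let m : E → ℝ := fun e => ((P.filter fun S => e ∈ S).card : ℝ)
  have hm0 : ∀ e, 0 ≤ m e := fun e => Nat.cast_nonneg _
  have hm : ∀ e, m e ≤ P.card := fun e => by
    exact Nat.cast_le.2 (Finset.card_le_card (Finset.filter_subset _ P))
  -- Each walk of `P` crosses `U` exactly once, so every minimum cut loses the same amount.
  have hmcut : ∀ U, IsMinCut ends s t U → ∑ e ∈ outFinset (Joins ends) U, m e = P.card := by
    intro U hU
    have h1 := sum_mul_card_inter (fun S => if S ∈ P then (1 : ℝ) else 0)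
      (outFinset (Joins ends) U)
    have h2 : ∀ e, m e = ∑ S with e ∈ S, (if S ∈ P then (1 : ℝ) else 0) := by
      intro e
      rw [← Finset.sum_filter, Finset.filter_filter, Finset.sum_const, nsmul_eq_mul, mul_one]
      simp only [m]
      congr 2
      ext S
      simp [and_comm]
    simp_rw [h2]
    rw [← h1]
    simp_rw [ite_mul, one_mul, zero_mul]
    rw [← Finset.sum_filter, Finset.filter_mem_eq_inter, Finset.univ_inter,
      Finset.sum_congr rfl (g := fun _ => (1 : ℝ))]
    · simp
    · intro S hS
      rw [(((hPmem S).1 hS).card_inter_of_forward hU).2 hU.2.1]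
      simp
  -- The capacity left after reserving `η * L` on every walk of `P`.
  let c : E → ℝ := fun e => L + δ e - η * L * m e
  have hc : ∀ e, 0 ≤ c e := by
    intro e
    have : η * m e ≤ 1 / 2 := (mul_le_mul_of_nonneg_left (hm e) hη0.le).trans hηP
    have : L * (η * m e) ≤ L * (1 / 2) := mul_le_mul_of_nonneg_left this hL0
    simp only [c]
    linarith [hδ e]
  have hcsum : ∀ U, IsMinCut ends s t U → ∑ e ∈ outFinset (Joins ends) U, c e =
      (outFinset (Joins ends) U).card * L + ∑ e ∈ outFinset (Joins ends) U, δ e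
        - η * L * P.card := by
    intro U hU
    simp only [c]
    rw [Finset.sum_sub_distrib, Finset.sum_add_distrib, ← Finset.mul_sum, hmcut U hU,
      Finset.sum_const, nsmul_eq_mul]
  have hunique : ∀ e u v u' v', Forward ends s t e u v → Forward ends s t e u' v' →
      (u' = u ∧ v' = v) ∨ (u' = v ∧ v' = u) := fun _ _ _ _ _ h h' => h.1.unique h'.1
  obtain ⟨f, hf, hr, hsum, hload⟩ := exists_walk_flow (A := Forward ends s t) (s := s) (t := t)
    (c := c) (F := ∑ e ∈ outFinset (Joins ends) W, c e) hunique hc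
    (Finset.sum_nonneg fun e _ => hc e) (by
      intro U h1 h2
      rw [← outFinset_def, hcsum W hW]
      rcases (hW.card_le_card_forward h1 h2).eq_or_lt with h3 | h3
      · obtain ⟨h4, h5⟩ := hW.of_card_forward h1 h2 h3.symm
        rw [h5, hcsum U h4, h3, h5]
        linarith [hWmin U h4]
      -- One more forward edge gains `L`. The reservation costs at most `L / 2`, and `L ≥ 2 * D`
      -- covers the `δ`-weight of `W`.
      · have h4 : ∑ e ∈ outFinset (Forward ends s t) U, (L - η * L * P.card) ≤
            ∑ e ∈ outFinset (Forward ends s t) U, c e := by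
          refine Finset.sum_le_sum fun e _ => ?_
          have := mul_le_mul_of_nonneg_left (hm e) (mul_nonneg hη0.le hL0)
          simp only [c]
          linarith [hδ e]
        refine le_trans ?_ h4
        rw [Finset.sum_const, nsmul_eq_mul]
        have h5 : ((outFinset (Joins ends) W).card : ℝ) + 1 ≤
            (outFinset (Forward ends s t) U).card := by exact_mod_cast h3
        have h6 : ((outFinset (Forward ends s t) U).card : ℝ) ≤ Fintype.card E := by
          exact_mod_cast Finset.card_le_univ _
        have h7 := mul_le_mul_of_nonneg_right h5 hL0
        have h8 := mul_le_mul_of_nonneg_right h6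
          (mul_nonneg (mul_nonneg hη0.le hL0) (Nat.cast_nonneg P.card : (0:ℝ) ≤ _))
        have h9 := mul_le_mul_of_nonneg_right hηE hL0
        have h10 : 0 ≤ η * L * P.card := by positivity
        linarith)
  have hPsum : ∀ g : Finset E → ℝ, (∀ S, g S ≠ 0 → f S ≠ 0) → ∑ S ∈ P, g S = ∑ S, g S := by
    intro g hg
    refine Finset.sum_subset (Finset.subset_univ _) fun S _ hS => ?_
    by_contra h
    exact hS ((hPmem S).2 (hr S (hg S h)))
  refine ⟨fun S => f S + η * L, fun S _ => by linarith [hf S], ?_, fun e => ?_⟩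
  · rw [Finset.sum_add_distrib, hPsum f (fun _ h => h), hsum, hcsum W hW, Finset.sum_const,
      Finset.sum_add_distrib, Finset.sum_const]
    simp only [nsmul_eq_mul]
    ring
  · have h1 : ∑ S ∈ P with e ∈ S, f S ≤ c e := by
      refine le_trans ?_ (hload e)
      exact Finset.sum_le_sum_of_subset_of_nonneg
        (Finset.filter_subset_filter _ (Finset.subset_univ _)) fun S _ _ => hf S
    rw [Finset.sum_add_distrib, Finset.sum_const, nsmul_eq_mul]
    simp only [c] at h1
    linarith

end MinimumCuts

/-! ### Rank bounds for the contraction -/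

namespace TensorNetwork

section Rank

variable {V : Type*} [Fintype V] (N : TensorNetwork V)

open scoped Classical in
theorem finrank_range_contraction (T : N.Assignment) :
    Module.finrank ℂ (LinearMap.range (N.contraction T)) = (N.contractionMatrix T).rank := rfl

/-- The `Fintype` instances are arguments so that the sum need not use those chosen in the
definition. -/
theorem contractionMatrix_apply_eq_sum [Fintype N.Labelling] [Fintype N.InnerVertex]
    (T : N.Assignment) (i : N.Index N.source) (j : N.Index N.sink) (w : N.Labelling → ℂ)
    (h₁ : ∀ l : N.Labelling, l.at N.source = i → l.at N.sink = j →
      ∏ u : N.InnerVertex, T u (l.at u) = w l)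
    (h₂ : ∀ l : N.Labelling, ¬ (l.at N.source = i ∧ l.at N.sink = j) → w l = 0) :
    N.contractionMatrix T j i = ∑ l, w l := by
  rw [contractionMatrix, Matrix.of_apply]
  refine Finset.sum_congr (by congr!) fun l _ => ?_
  split_ifs with h
  · rw [← h₁ l h.1 h.2]
    congr!
  · exact (h₂ l h).symm

theorem sum_mul_sum_fiber {α β : Type*} [Fintype α] [Fintype β] [DecidableEq β] (r : α → β)
    (a : β → ℂ) (g : α → ℂ) : ∑ κ, a κ * ∑ l with r l = κ, g l = ∑ l, a (r l) * g l := by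
  rw [← Finset.sum_fiberwise Finset.univ r]
  refine Finset.sum_congr rfl fun κ _ => ?_
  rw [Finset.mul_sum]
  refine Finset.sum_congr rfl fun l hl => ?_
  rw [(Finset.mem_filter.1 hl).2]

open scoped Classical in
/-- If the labels given by a family of linking walks fit into the edge dimensions, then copying
them along the walks gives an identity submatrix of the contraction. -/
theorem prod_le_maxFlow
    (P : Finset (Finset N.graph.edgeSet))
    (hP : ∀ S ∈ P, Reach (Joins (Subtype.val : N.graph.edgeSet → Sym2 V)) N.source N.sink S)
    (q : Finset N.graph.edgeSet → ℕ) (hq : ∀ e, ∏ S ∈ P with e ∈ S, q S ≤ N.dim e) :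
    ∏ S ∈ P, q S ≤ N.maxFlow := by
  classical
  -- The label of `e` encodes the indices of all walks through `e`.
  have henc : ∀ e, ∃ enc : ((S : {S // S ∈ P.filter fun S => e ∈ S}) → Fin (q S)) → Fin (N.dim e),
      Function.Injective enc := by
    intro e
    have h : Fintype.card ((S : {S // S ∈ P.filter fun S => e ∈ S}) → Fin (q S)) ≤
        Fintype.card (Fin (N.dim e)) := by
      rw [Fintype.card_pi, Fintype.card_fin]
      simp only [Fintype.card_fin]
      rw [Finset.prod_coe_sort (P.filter fun S => e ∈ S) q]
      exact hq e
    obtain ⟨g⟩ := Function.Embedding.nonempty_of_card_le h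
    exact ⟨g, g.injective⟩
  choose enc henc using henc
  let label : ((S : P) → Fin (q S)) → N.Labelling := fun x e =>
    enc e fun S => x ⟨S.1, (Finset.mem_filter.1 S.2).1⟩
  have hlabel : ∀ x y e, label x e = label y e → ∀ S : P, e ∈ S.1 → x S = y S := by
    intro x y e h S hS
    exact congrFun (henc e h) ⟨S.1, Finset.mem_filter.2 ⟨S.2, hS⟩⟩
  let T : N.Assignment := fun u i => if ∃ x, i = (label x).at u then 1 else 0
  have key : ∀ x y l, (l.at N.source = (label x).at N.source ∧ l.at N.sink = (label y).at N.sink ∧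
      ∀ u : N.InnerVertex, ∃ z, l.at u = (label z).at u) ↔ l = label x ∧ x = y := by
    intro x y l
    refine ⟨fun ⟨hs, ht, hin⟩ => ?_, fun ⟨h1, h2⟩ => ?_⟩
    -- Every vertex sees labels coming from some index tuple `z u`. Neighbouring tuples agree on the
    -- walks through their common edge, so `z u S` is constant along `S`; this links `x` at the
    -- source to `y` at the sink.
    · have hall : ∀ u, ∃ z, (∀ e : N.graph.edgeSet, u ∈ (e : Sym2 V) → l e = label z e) ∧
          (u = N.source → z = x) ∧ (u = N.sink → z = y) := by
        intro u
        by_cases h1 : u = N.source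
        · subst h1
          exact ⟨x, fun e he => congrFun hs ⟨e, he⟩, fun _ => rfl,
            fun h => absurd h N.source_ne_sink⟩
        · by_cases h2 : u = N.sink
          · subst h2
            exact ⟨y, fun e he => congrFun ht ⟨e, he⟩, fun h => absurd h h1, fun _ => rfl⟩
          · obtain ⟨z, hz⟩ := hin ⟨u, h1, h2⟩
            exact ⟨z, fun e he => congrFun hz ⟨e, he⟩, fun h => absurd h h1, fun h => absurd h h2⟩
      choose z hz hzs hzt using hall
      have hadj : ∀ (S : P) (e : N.graph.edgeSet) (u v : V), e ∈ S.1 → u ∈ (e : Sym2 V) →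
          v ∈ (e : Sym2 V) → z u S = z v S := by
        intro S e u v he hu hv
        exact hlabel _ _ e ((hz u e hu).symm.trans (hz v e hv)) S he
      have hwalk : ∀ S : P, z N.sink S = x S ∧
          ∀ e ∈ S.1, ∃ u v, Joins (Subtype.val : N.graph.edgeSet → Sym2 V) e u v ∧ z v S = x S :=
        fun S => (hP S S.2).forall_of_step (Q := fun v => z v S = x S) (by rw [hzs _ rfl])
          fun e he u v ha hu => (hadj S e v u he ha.symm.mem_left ha.mem_left).trans hu
      refine ⟨?_, ?_⟩
      · funext e
        obtain ⟨u, hu⟩ : ∃ u, u ∈ (e : Sym2 V) := ⟨_, Sym2.out_fst_mem _⟩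
        rw [hz u e hu]
        refine congrArg (enc e) (funext fun S => ?_)
        have hS := Finset.mem_filter.1 S.2
        obtain ⟨_, v, ha, hv⟩ := (hwalk ⟨S.1, hS.1⟩).2 e hS.2
        exact (hadj ⟨S.1, hS.1⟩ e u v hS.2 hu ha.symm.mem_left).trans hv
      · funext S
        rw [← (hwalk S).1, hzt _ rfl]
    · subst h1 h2
      exact ⟨rfl, rfl, fun u => ⟨_, rfl⟩⟩
  have hsub : (N.contractionMatrix T).submatrix (fun y => (label y).at N.sink)
      (fun x => (label x).at N.source) = 1 := by
    ext y x
    rw [Matrix.submatrix_apply, Matrix.one_apply, contractionMatrix_apply_eq_sum N T _ _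
      (fun l => if l = label x ∧ x = y then 1 else 0)]
    rotate_left
    · intro l h1 h2
      by_cases hl : l = label x ∧ x = y
      · rw [if_pos hl]
        exact Finset.prod_eq_one fun u _ => if_pos (((key x y l).2 hl).2.2 u)
      · rw [if_neg hl]
        obtain ⟨u, hu⟩ := not_forall.1 fun h => hl ((key x y l).1 ⟨h1, h2, h⟩)
        exact Finset.prod_eq_zero (Finset.mem_univ u) (if_neg hu)
    · intro l h
      rw [if_neg]
      intro h1
      have := (key x y l).2 h1
      exact h ⟨this.1, this.2.1⟩
    by_cases h : x = y
    · simp [h]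
    · simp [h, Ne.symm h]
  have hrank := Matrix.rank_submatrix_le (N.contractionMatrix T) (fun y => (label y).at N.sink)
      (fun x => (label x).at N.source)
  rw [hsub, Matrix.rank_one, Fintype.card_pi] at hrank
  simp only [Fintype.card_fin] at hrank
  rw [Finset.prod_coe_sort P q] at hrank
  exact hrank.trans (N.isGreatest_maxFlow.2 ⟨T, (finrank_range_contraction N T).symm⟩)

/-- The contraction factors through the edges of any cut. -/
theorem maxFlow_le_cutCapacity {A : Set V} (hs : N.source ∈ A)
    (ht : N.sink ∉ A) : N.maxFlow ≤ N.cutCapacity A := by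
  classical
  obtain ⟨T, hT⟩ := N.isGreatest_maxFlow.1
  rw [hT, finrank_range_contraction]
  -- The edges touching `A` determine the `A`-side factor `G`; the cut edges `C` and the edges not
  -- touching `A` determine the other factor `H`. Summing over labels of `C` gives the matrix
  -- product.
  let p : N.graph.edgeSet → Prop := fun e => ∃ u ∈ A, u ∈ (e : Sym2 V)
  let C : Finset N.graph.edgeSet := Finset.univ.filter fun e => Crosses A (e : Sym2 V)
  have hpos : ∀ e, 0 < N.dim e := fun e => zero_lt_two.trans_le (N.two_le_dim e)
  have hCp : ∀ e ∈ C, p e := by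
    intro e he
    obtain ⟨u, v, h, hu, -⟩ := (Finset.mem_filter.1 he).2
    exact ⟨u, hu, by rw [h]; exact Sym2.mem_mk_left _ _⟩
  have hmemC : ∀ e, p e → ∀ v ∉ A, v ∈ (e : Sym2 V) → e ∈ C := by
    rintro e ⟨u, hu, hue⟩ v hv hve
    refine Finset.mem_filter.2 ⟨Finset.mem_univ _, u, v, ?_, hu, hv⟩
    exact (Sym2.mem_and_mem_iff (by rintro rfl; exact hv hu)).1 ⟨hue, hve⟩
  let G : N.Index N.source → N.Labelling → ℂ := fun i l =>
    (if l.at N.source = i then 1 else 0) *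
      ∏ u : N.InnerVertex, if u.1 ∈ A then T u (l.at u) else 1
  let H : N.Index N.sink → N.Labelling → ℂ := fun j l =>
    (if l.at N.sink = j then 1 else 0) *
      ∏ u : N.InnerVertex, if u.1 ∈ A then 1 else T u (l.at u)
  have hG : ∀ i l l', (∀ e, p e → l e = l' e) → G i l = G i l' := by
    intro i l l' h
    have hat : ∀ u ∈ A, l.at u = l'.at u := fun u hu => funext fun e => h _ ⟨u, hu, e.2⟩
    simp only [G]
    rw [hat _ hs]
    congr 1
    refine Finset.prod_congr rfl fun u _ => ?_
    split_ifs with hu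
    · rw [hat _ hu]
    · rfl
  have hH : ∀ j l l', (∀ e, (p e → e ∈ C) → l e = l' e) → H j l = H j l' := by
    intro j l l' h
    have hat : ∀ u ∉ A, l.at u = l'.at u := fun u hu =>
      funext fun e => h _ fun hp => hmemC _ hp u hu e.2
    simp only [H]
    rw [hat _ ht]
    congr 1
    refine Finset.prod_congr rfl fun u _ => ?_
    split_ifs with hu
    · rfl
    · rw [hat _ hu]
  let φ := Equiv.piEquivPiSubtypeProd p fun e => Fin (N.dim e)
  let r : ((e : {e // p e}) → Fin (N.dim e.1)) → ((e : C) → Fin (N.dim e.1)) :=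
    fun l₁ e => l₁ ⟨e.1, hCp _ e.2⟩
  -- The default label `0` goes to edges inside `A`, which `H` ignores.
  let fill : ((e : C) → Fin (N.dim e.1)) → ((e : {e // p e}) → Fin (N.dim e.1)) :=
    fun κ e => if h : e.1 ∈ C then κ ⟨e.1, h⟩ else ⟨0, hpos _⟩
  let M₁ : Matrix ((e : C) → Fin (N.dim e.1)) (N.Index N.source) ℂ := Matrix.of fun κ i =>
    ∑ l₁ with r l₁ = κ, G i (φ.symm (l₁, fun e => ⟨0, hpos _⟩))
  let M₂ : Matrix (N.Index N.sink) ((e : C) → Fin (N.dim e.1)) ℂ := Matrix.of fun j κ =>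
    ∑ l₂, H j (φ.symm (fill κ, l₂))
  have hmul : N.contractionMatrix T = M₂ * M₁ := by
    ext j i
    rw [Matrix.mul_apply]
    simp only [M₁, M₂, Matrix.of_apply]
    rw [contractionMatrix_apply_eq_sum N T i j (fun l => G i l * H j l), sum_mul_sum_fiber,
      ← φ.symm.sum_comp, Fintype.sum_prod_type]
    rotate_left
    · intro l h1 h2
      simp only [G, H, h1, h2, if_true, one_mul]
      rw [← Finset.prod_mul_distrib]
      refine Finset.prod_congr rfl fun u _ => ?_
      split_ifs <;> simp
    · intro l h
      by_cases h1 : l.at N.source = i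
      · have h2 : l.at N.sink ≠ j := fun h2 => h ⟨h1, h2⟩
        simp only [H, if_neg h2, zero_mul, mul_zero]
      · simp only [G, if_neg h1, zero_mul]
    refine Finset.sum_congr rfl fun l₁ _ => ?_
    rw [Finset.sum_mul]
    refine Finset.sum_congr rfl fun l₂ _ => ?_
    rw [mul_comm]
    refine congrArg₂ (· * ·) ?_ ?_
    · refine hH _ _ _ fun e he => ?_
      by_cases hp : p e
      · simp [φ, Equiv.piEquivPiSubtypeProd, hp, fill, he hp, r]
      · simp [φ, Equiv.piEquivPiSubtypeProd, hp]
    · refine hG _ _ _ fun e hp => ?_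
      simp [φ, Equiv.piEquivPiSubtypeProd, hp]
  rw [hmul]
  refine (Matrix.rank_mul_le_left _ _).trans ((Matrix.rank_le_card_width _).trans_eq ?_)
  rw [Fintype.card_pi]
  simp only [Fintype.card_fin]
  rw [Finset.prod_coe_sort C N.dim]
  simp only [cutCapacity, C]

end Rank

end TensorNetwork

/-! ### Rounding the flow and passing to the limit -/

/-- Rounding the exponentials of large numbers down to integers loses only a factor close to `1`. -/
theorem exp_sum_mul_pow_le_prod_floor {ι : Type*} (P : Finset ι) (f : ι → ℝ) {x : ℝ} (hx : 0 ≤ x)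
    (hf : ∀ S ∈ P, x ≤ f S) :
    Real.exp (∑ S ∈ P, f S) * (1 - Real.exp (-x)) ^ P.card ≤ ∏ S ∈ P, (⌊Real.exp (f S)⌋₊ : ℝ) := by
  rw [Real.exp_sum, ← Finset.prod_const, ← Finset.prod_mul_distrib]
  have h0 : 0 ≤ 1 - Real.exp (-x) := by
    rw [sub_nonneg]
    exact Real.exp_le_one_iff.2 (by linarith)
  refine Finset.prod_le_prod (fun S _ => mul_nonneg (Real.exp_pos _).le h0) fun S hS => ?_
  have h1 : Real.exp (f S) * Real.exp (-x) ≥ 1 := by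
    rw [← Real.exp_add]
    exact Real.one_le_exp (by linarith [hf S hS])
  linarith [Nat.lt_floor_add_one (Real.exp (f S))]

namespace TensorNetwork

section Limit

variable {V : Type*} [Fintype V] (N : TensorNetwork V)

theorem minCut_pos : 0 < N.minCut := by
  obtain ⟨A, -, -, h⟩ := N.isLeast_minCut.1
  rw [h]
  exact Finset.prod_pos fun e _ => zero_lt_two.trans_le (N.two_le_dim e)

theorem maxFlow_le_minCut : N.maxFlow ≤ N.minCut := by
  obtain ⟨A, hs, ht, h⟩ := N.isLeast_minCut.1
  rw [h]
  exact N.maxFlow_le_cutCapacity hs ht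

open scoped Classical in
/-- A flow along walks that fits the logarithmic edge dimensions, is as large as a cut and has no
small nonzero parts gives a lower bound for the max-flow. -/
theorem minCut_mul_le_maxFlow [inst : DecidableEq N.graph.edgeSet]
    (P : Finset (Finset N.graph.edgeSet))
    (hP : ∀ S ∈ P, Reach (Joins (Subtype.val : N.graph.edgeSet → Sym2 V)) N.source N.sink S)
    {W : Set V} (hs : N.source ∈ W) (ht : N.sink ∉ W) (f : Finset N.graph.edgeSet → ℝ) {x : ℝ}
    (hx : 0 ≤ x) (hf : ∀ S ∈ P, x ≤ f S)
    (hsum : ∑ S ∈ P, f S =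
      ∑ e ∈ outFinset (Joins (Subtype.val : N.graph.edgeSet → Sym2 V)) W, Real.log (N.dim e))
    (hload : ∀ e, ∑ S ∈ P with e ∈ S, f S ≤ Real.log (N.dim e)) :
    (N.minCut : ℝ) * (1 - Real.exp (-x)) ^ P.card ≤ N.maxFlow := by
  have hexp : ∀ e, Real.exp (Real.log (N.dim e)) = N.dim e := fun e => Real.exp_log (by
    exact_mod_cast zero_lt_two.trans_le (N.two_le_dim e))
  have hflow := N.prod_le_maxFlow P hP (fun S => ⌊Real.exp (f S)⌋₊) (by
    intro e
    have h : ∏ S ∈ P with e ∈ S, (⌊Real.exp (f S)⌋₊ : ℝ) ≤ N.dim e := by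
      rw [← hexp]
      refine le_trans ?_ (Real.exp_le_exp.2 (hload e))
      rw [Real.exp_sum]
      exact Finset.prod_le_prod (fun _ _ => Nat.cast_nonneg _) fun S _ =>
        Nat.floor_le (Real.exp_pos _).le
    rw [← Nat.cast_prod, Nat.cast_le] at h
    convert h)
  -- That `W` is a cut suffices here; its minimality is not needed.
  have hcut : (N.minCut : ℝ) ≤ Real.exp (∑ S ∈ P, f S) := by
    have h : (N.minCut : ℝ) ≤ N.cutCapacity W := by
      exact_mod_cast N.isLeast_minCut.2 ⟨W, hs, ht, rfl⟩
    refine h.trans_eq ?_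
    rw [hsum, Real.exp_sum, cutCapacity, Nat.cast_prod]
    refine Finset.prod_congr ?_ fun e _ => (hexp e).symm
    ext e
    rw [mem_outFinset, Finset.mem_filter]
    constructor
    · rintro ⟨-, u, v, h, hu, hv⟩
      exact ⟨u, hu, v, hv, h⟩
    · rintro ⟨u, hu, v, hv, h⟩
      exact ⟨Finset.mem_univ _, u, v, h, hu, hv⟩
  have h0 : 0 ≤ 1 - Real.exp (-x) := sub_nonneg.2 (Real.exp_le_one_iff.2 (by linarith))
  calc _ ≤ Real.exp (∑ S ∈ P, f S) * (1 - Real.exp (-x)) ^ P.card :=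
        mul_le_mul_of_nonneg_right hcut (pow_nonneg h0 _)
    _ ≤ ∏ S ∈ P, (⌊Real.exp (f S)⌋₊ : ℝ) := exp_sum_mul_pow_le_prod_floor P f hx hf
    _ ≤ _ := by exact_mod_cast hflow

theorem tendsto_log_pnat : Tendsto (fun n : ℕ+ => Real.log n) atTop atTop :=
  Real.tendsto_log_atTop.comp (tendsto_natCast_atTop_atTop.comp tendsto_PNat_val_atTop_atTop)

open scoped Classical in
/-- For large `n` the max-flow of `nN` is at least the min-cut up to a factor tending to `1`. -/
theorem exists_eventually_minCut_mul_le_maxFlow :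
    ∃ (η : ℝ) (k : ℕ), 0 < η ∧ ∀ᶠ n : ℕ+ in atTop,
      ((N.scale n).minCut : ℝ) * (1 - Real.exp (-(η * Real.log n))) ^ k ≤ (N.scale n).maxFlow := by
  obtain ⟨P, W, η, L₀, hη, hs, ht, hP, hL⟩ := exists_large_walk_flow (E := N.graph.edgeSet)
    (ends := (Subtype.val : N.graph.edgeSet → Sym2 V)) N.source_ne_sink
    (fun e => Real.log (N.dim e)) (fun e => Real.log_natCast_nonneg _)
  refine ⟨η, P.card, hη, ?_⟩
  filter_upwards [tendsto_log_pnat.eventually_ge_atTop L₀] with n hn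
  obtain ⟨f, hf, hsum, hload⟩ := hL _ hn
  have hlog : ∀ e, Real.log n + Real.log (N.dim e) = Real.log ((N.scale n).dim e) := by
    intro e
    rw [← Real.log_mul (by simp) (by
      have := N.two_le_dim e
      exact_mod_cast (by lia : N.dim e ≠ 0)), ← Nat.cast_mul]
    rfl
  refine (N.scale n).minCut_mul_le_maxFlow
    (inst := fun a b => Classical.propDecidable (a = b)) P hP hs ht f
    (mul_nonneg hη.le (Real.log_natCast_nonneg _)) hf ?_ fun e => ?_
  · exact hsum.trans (Finset.sum_congr rfl fun e _ => hlog e)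
  · exact (hload e).trans_eq (hlog e)

end Limit

end TensorNetwork

theorem mainTheorem2 {V : Type*} [Fintype V] (N : TensorNetwork V) :
    Tendsto (fun n : ℕ+ => ((N.scale n).maxFlow : ℝ) / ((N.scale n).minCut : ℝ)) atTop (𝓝 1) := by
  obtain ⟨η, k, hη, hlow⟩ := N.exists_eventually_minCut_mul_le_maxFlow
  have hpos : ∀ n, (0 : ℝ) < (N.scale n).minCut := fun n => by
    exact_mod_cast (N.scale n).minCut_pos
  have hlim : Tendsto (fun n : ℕ+ => (1 - Real.exp (-(η * Real.log n))) ^ k) atTop (𝓝 1) := by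
    have h := ((tendsto_const_nhds (x := (1 : ℝ))).sub
      (Real.tendsto_exp_neg_atTop_nhds_zero.comp (TensorNetwork.tendsto_log_pnat.const_mul_atTop hη))).pow k
    simpa using h
  -- The ratio is squeezed between `(1 - n ^ (-η)) ^ k` and `1`.
  refine tendsto_of_tendsto_of_tendsto_of_le_of_le' hlim tendsto_const_nhds ?_ ?_
  · filter_upwards [hlow] with n hn
    rw [le_div_iff₀ (hpos n), mul_comm]
    exact hn
  · refine Eventually.of_forall fun n => ?_
    rw [div_le_one (hpos n)]
    exact_mod_cast (N.scale n).maxFlow_le_minCut
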